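/- Let $\zeta$ denote the Riemann zeta function and let $\gamma_1$ be the first Stieltjes constant, where the Stieltjes constants $\gamma_\ell$ ($\ell\ge 0$) are defined by the Laurent expansion of $\zeta$ at $s=1$, \[ \zeta(s)=\frac{1}{s-1}+\sum_{\ell=0}^{\infty}\frac{(-1)^\ell}{\ell!}\,\gamma_\ell\,(s-1)^\ell . \] Then the series below converges and \[ \gamma_1=\sum_{j=1}^{\infty}\frac{\zeta'(2j+1)}{2j+1}. \] -/

import Mathlib

/-- The Stieltjes constants `γ_ℓ`, defined through the Laurent expansion of the Riemann zeta function
at its pole `s = 1`: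
`ζ(s) = 1 / (s - 1) + ∑ (-1)^ℓ / ℓ! * γ_ℓ * (s - 1)^ℓ`.
Here `riemannZeta₀` is Mathlib's entire function that equals `ζ(s) - 1 / (s - 1)` for `s ≠ 1`. -/
noncomputable def stieltjesConstant (l : ℕ) : ℂ :=
  (-1) ^ l * iteratedDeriv l riemannZeta₀ 1

/-- The Laurent expansion that characterises the Stieltjes constants. -/
theorem hasSum_stieltjesConstant {s : ℂ} (hs : s ≠ 1) :
    HasSum (fun l : ℕ => (-1) ^ l / (l.factorial : ℂ) * stieltjesConstant l * (s - 1) ^ l)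
      (riemannZeta s - 1 / (s - 1)) := by
  have h := Complex.hasSum_taylorSeries_of_entire differentiable_riemannZeta₀ 1 s
  have h0 : riemannZeta₀ s = riemannZeta s - 1 / (s - 1) := by
    rw [riemannZeta_eq_inv_sub_add hs]; ring
  rw [← h0]
  refine h.congr_fun ?_
  intro l
  have h1 : ((-1 : ℂ) ^ l) * (-1) ^ l = 1 := by rw [← mul_pow]; norm_num
  simp only [stieltjesConstant, smul_eq_mul]
  linear_combination ((l.factorial : ℂ)⁻¹ * iteratedDeriv l riemannZeta₀ 1 * (s - 1) ^ l) * h1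

open Filter Topology Finset

/-! Since `-ζ'(s) = ∑ log n · n^(-s)` for `s > 1`, the series is minus a double sum of the
nonnegative terms `log n / (k n^k)`, `n ≥ 2`, `k ≥ 3` odd, so the order of summation can be
exchanged. Summing over `k` gives `log n · (artanh (1/n) - 1/n)` with `2 artanh (1/n) = log (n+1) -
log (n-1)`; the sum over `n ≤ N` therefore telescopes (`sum_range_logArtanhTerm`) to `log N · log
(N+1) / 2 - ∑ log n / n`. This tends to `-γ₁` by the classical limit formula, which comes from
comparing `log n · n^(-s)` with its integral over `[n, n+1]`, uniformly in `s`
(`abs_logRpowGap_le`), and letting `s → 1⁺` in `hasSum_logRpowGap`. -/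

lemma hasDerivAt_log_mul_rpow_neg {x : ℝ} (hx : 0 < x) (s : ℝ) :
    HasDerivAt (fun x : ℝ => Real.log x * x ^ (-s)) (x ^ (-s - 1) * (1 - s * Real.log x)) x := by
  have h := (Real.hasDerivAt_log hx.ne').mul (Real.hasDerivAt_rpow_const (p := -s) (Or.inl hx.ne'))
  refine h.congr_deriv ?_
  rw [Real.rpow_sub hx, Real.rpow_one]
  field_simp
  ring

lemma hasDerivAt_antideriv_log_mul_rpow_neg {x s : ℝ} (hx : 0 < x) (hs : s ≠ 1) :
    HasDerivAt (fun x : ℝ => -(x ^ (1 - s) * (Real.log x / (s - 1) + 1 / (s - 1) ^ 2)))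
      (Real.log x * x ^ (-s)) x := by
  have h := ((Real.hasDerivAt_rpow_const (p := 1 - s) (Or.inl hx.ne')).mul
    (((Real.hasDerivAt_log hx.ne').div_const (s - 1)).add_const (1 / (s - 1) ^ 2))).neg
  refine h.congr_deriv ?_
  have h1 : s - 1 ≠ 0 := sub_ne_zero.2 hs
  have h2 : x ^ (1 - s) = x * x ^ (-s) := by
    rw [sub_eq_add_neg, Real.rpow_add hx, Real.rpow_one]
  rw [h2, show (1 - s - 1 : ℝ) = -s by ring]
  field_simp
  ring

lemma uIcc_subset_Ioi_zero {a b : ℝ} (ha : 0 < a) (hb : 0 < b) : Set.uIcc a b ⊆ Set.Ioi 0 :=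
  fun _ hx => (lt_min ha hb).trans_le hx.1

lemma continuousOn_log_mul_rpow_neg (s : ℝ) :
    ContinuousOn (fun x : ℝ => Real.log x * x ^ (-s)) (Set.Ioi 0) :=
  fun _ hx => (hasDerivAt_log_mul_rpow_neg hx s).continuousAt.continuousWithinAt

lemma intervalIntegrable_log_mul_rpow_neg {a b : ℝ} (ha : 0 < a) (hb : 0 < b) (s : ℝ) :
    IntervalIntegrable (fun x : ℝ => Real.log x * x ^ (-s)) MeasureTheory.volume a b :=
  ((continuousOn_log_mul_rpow_neg s).mono (uIcc_subset_Ioi_zero ha hb)).intervalIntegrable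

lemma integral_log_mul_rpow_neg {a b s : ℝ} (ha : 0 < a) (hb : 0 < b) (hs : s ≠ 1) :
    ∫ x in a..b, Real.log x * x ^ (-s) =
      -(b ^ (1 - s) * (Real.log b / (s - 1) + 1 / (s - 1) ^ 2)) -
      -(a ^ (1 - s) * (Real.log a / (s - 1) + 1 / (s - 1) ^ 2)) :=
  intervalIntegral.integral_eq_sub_of_hasDerivAt
    (fun _ hx => hasDerivAt_antideriv_log_mul_rpow_neg (uIcc_subset_Ioi_zero ha hb hx) hs)
    (intervalIntegrable_log_mul_rpow_neg ha hb s)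

lemma integral_log_mul_rpow_neg_one {a b : ℝ} (ha : 0 < a) (hb : 0 < b) :
    ∫ x in a..b, Real.log x * x ^ (-1 : ℝ) = Real.log b ^ 2 / 2 - Real.log a ^ 2 / 2 := by
  refine intervalIntegral.integral_eq_sub_of_hasDerivAt (f := fun x => Real.log x ^ 2 / 2)
    (fun x hx => ?_) (intervalIntegrable_log_mul_rpow_neg ha hb 1)
  have hx' : 0 < x := uIcc_subset_Ioi_zero ha hb hx
  refine (((Real.hasDerivAt_log hx'.ne').pow 2).div_const 2).congr_deriv ?_
  rw [Real.rpow_neg_one]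
  simp
  ring

/-! ### Comparison of sum and integral, uniformly in `s` -/

/-- The difference between `log n / n ^ s` and the integral of `log x / x ^ s` over `[n, n + 1]`,
at `n = m + 1`. -/
noncomputable def logRpowGap (s : ℝ) (m : ℕ) : ℝ :=
  Real.log (m + 1) * ((m : ℝ) + 1) ^ (-s) -
    ∫ x in ((m : ℝ) + 1)..((m + 1 : ℕ) + 1), Real.log x * x ^ (-s)

lemma abs_logRpowGap_le {s : ℝ} (h1 : 1 ≤ s) (h2 : s ≤ 2) (m : ℕ) :
    |logRpowGap s m| ≤ 5 * ((m : ℝ) + 1) ^ (-(3 / 2) : ℝ) := by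
  set a : ℝ := (m : ℝ) + 1 with ha
  have ha1 : 1 ≤ a := by simp [ha]
  have ha0 : 0 < a := by linarith
  have hb : ((m + 1 : ℕ) : ℝ) + 1 = a + 1 := by push_cast; rfl
  have bound : ∀ x ∈ Set.Ico a (a + 1),
      ‖x ^ (-s - 1) * (1 - s * Real.log x)‖ ≤ 5 * a ^ (-(3 / 2) : ℝ) := by
    intro x hx
    have hx1 : 1 ≤ x := ha1.trans hx.1
    have hx0 : 0 < x := by linarith
    have hl0 : 0 ≤ Real.log x := Real.log_nonneg hx1
    -- Half a power of `x` pays for the logarithm: `x^(-2)` becomes `x^(-3/2)`, still summable, and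
    -- `|1 - s log x| ≤ 1 + 2 · 2 x^(1/2)` gives the constant `5`.
    have hl : Real.log x ≤ 2 * x ^ (1 / 2 : ℝ) := by
      have := Real.log_le_rpow_div hx0.le (ε := 1 / 2) (by norm_num)
      linarith
    have hr : 1 ≤ x ^ (1 / 2 : ℝ) := Real.one_le_rpow hx1 (by norm_num)
    have e1 : |1 - s * Real.log x| ≤ 5 * x ^ (1 / 2 : ℝ) := by
      rw [abs_le]
      constructor <;> nlinarith [mul_nonneg (sub_nonneg.2 h2) hl0, mul_nonneg (by linarith : 0 ≤ s) hl0]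
    have e2 : x ^ (-s - 1) ≤ x ^ (-2 : ℝ) := Real.rpow_le_rpow_of_exponent_le hx1 (by linarith)
    rw [norm_mul, Real.norm_of_nonneg (Real.rpow_nonneg hx0.le _), Real.norm_eq_abs]
    calc x ^ (-s - 1) * |1 - s * Real.log x| ≤ x ^ (-2 : ℝ) * (5 * x ^ (1 / 2 : ℝ)) :=
          mul_le_mul e2 e1 (abs_nonneg _) (Real.rpow_nonneg hx0.le _)
      _ = 5 * x ^ (-(3 / 2) : ℝ) := by
          rw [mul_left_comm, ← Real.rpow_add hx0]; norm_num
      _ ≤ 5 * a ^ (-(3 / 2) : ℝ) := by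
          gcongr 5 * ?_
          exact Real.rpow_le_rpow_of_nonpos ha0 hx.1 (by norm_num)
  have mvt := norm_image_sub_le_of_norm_deriv_le_segment'
    (f := fun x : ℝ => Real.log x * x ^ (-s)) (fun x hx => (hasDerivAt_log_mul_rpow_neg
      (ha0.trans_le hx.1) s).hasDerivWithinAt) bound
  have hC : 0 ≤ 5 * a ^ (-(3 / 2) : ℝ) := by positivity
  -- The interval has length `1`, so the value at `a` is also the integral of a constant.
  have key : logRpowGap s m = -∫ x in a..(a + 1), (Real.log x * x ^ (-s) - Real.log a * a ^ (-s)) := by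
    rw [intervalIntegral.integral_sub (intervalIntegrable_log_mul_rpow_neg ha0 (by linarith) s)
      intervalIntegrable_const, logRpowGap, hb]
    simp [ha]
  rw [key, abs_neg, ← Real.norm_eq_abs]
  have := intervalIntegral.norm_integral_le_of_norm_le_const (a := a) (b := a + 1)
    (f := fun x => Real.log x * x ^ (-s) - Real.log a * a ^ (-s)) (C := 5 * a ^ (-(3 / 2) : ℝ))
    (fun x hx => by
      rw [Set.uIoc_of_le (by linarith)] at hx
      refine (mvt x ⟨hx.1.le, hx.2⟩).trans ?_
      exact mul_le_of_le_one_right hC (by linarith [hx.2]))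
  simpa using this

lemma summable_nat_add_one_rpow_neg {p : ℝ} (hp : 1 < p) :
    Summable fun m : ℕ => ((m : ℝ) + 1) ^ (-p) := by
  have := (summable_nat_add_iff 1).2 (Real.summable_nat_rpow.2 (neg_lt_neg hp))
  simpa using this

lemma tendsto_logRpowGap (m : ℕ) :
    Tendsto (fun s => logRpowGap s m) (𝓝[>] 1) (𝓝 (logRpowGap 1 m)) := by
  have ha : (1 : ℝ) ≤ (m : ℝ) + 1 := by simp
  have hpos : (0 : ℝ) < (m : ℝ) + 1 := by linarith
  have hc : ∀ x : ℝ, 0 < x → Tendsto (fun s : ℝ => Real.log x * x ^ (-s)) (𝓝[>] 1)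
      (𝓝 (Real.log x * x ^ (-1 : ℝ))) := fun x hx =>
    (((Real.continuous_const_rpow hx.ne').comp continuous_neg).const_mul
      (Real.log x)).continuousAt.tendsto.mono_left nhdsWithin_le_nhds
  refine (hc _ hpos).sub ?_
  refine intervalIntegral.tendsto_integral_filter_of_dominated_convergence
    (fun x => Real.log x * x ^ (-1 : ℝ)) ?_ ?_ ?_ ?_
  · refine Eventually.of_forall fun s => ?_
    exact (intervalIntegrable_iff.1
      (intervalIntegrable_log_mul_rpow_neg hpos (by positivity) s)).aestronglyMeasurable
  · filter_upwards [self_mem_nhdsWithin] with s hs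
    refine MeasureTheory.ae_of_all _ fun x hx => ?_
    rw [Set.uIoc_of_le (by push_cast; linarith)] at hx
    have hx1 : 1 ≤ x := ha.trans hx.1.le
    have := Real.log_nonneg hx1
    rw [Real.norm_of_nonneg (by positivity)]
    exact mul_le_mul_of_nonneg_left
      (Real.rpow_le_rpow_of_exponent_le hx1 (neg_le_neg (le_of_lt hs))) this
  · exact intervalIntegrable_log_mul_rpow_neg hpos (by positivity) 1
  · refine MeasureTheory.ae_of_all _ fun x hx => ?_
    rw [Set.uIoc_of_le (by push_cast; linarith)] at hx
    exact hc x (hpos.trans hx.1)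

/-! ### The limit formula for `γ₁` -/

lemma hasSum_deriv_riemannZeta {s : ℝ} (hs : 1 < s) :
    HasSum (fun m : ℕ => ((Real.log (m + 1) * ((m : ℝ) + 1) ^ (-s) : ℝ) : ℂ))
      (-deriv riemannZeta s) := by
  have hs' : LSeries.abscissaOfAbsConv 1 < ((s : ℂ).re : EReal) := by
    rw [LSeries.abscissaOfAbsConv_one]
    exact_mod_cast hs
  have h := (LSeriesSummable_logMul_of_lt_re hs').LSeriesHasSum
  have hd : deriv riemannZeta s = deriv (LSeries 1) s := by
    refine Filter.EventuallyEq.deriv_eq ?_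
    filter_upwards [(isOpen_lt continuous_const Complex.continuous_re).mem_nhds
      (show 1 < (s : ℂ).re from hs)] with z hz
    exact (LSeries_one_eq_riemannZeta hz).symm
  rw [hd, LSeries_deriv hs', neg_neg]
  unfold LSeriesHasSum at h
  rw [← hasSum_nat_add_iff' 1] at h
  simp only [sum_range_one, LSeries.term_zero, sub_zero] at h
  refine h.congr_fun fun m => ?_
  rw [LSeries.term_of_ne_zero (Nat.succ_ne_zero m)]
  have h0 : (0 : ℝ) ≤ (m : ℝ) + 1 := by positivity
  simp only [LSeries.logMul, Pi.one_apply, mul_one]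
  rw [Complex.ofReal_mul, Complex.ofReal_log h0, Complex.ofReal_cpow h0, Complex.ofReal_neg,
    Complex.cpow_neg, div_eq_mul_inv]
  push_cast
  rfl

lemma hasSum_integral_log_mul_rpow_neg {s : ℝ} (hs : 1 < s) :
    HasSum (fun m : ℕ => ∫ x in ((m : ℝ) + 1)..((m + 1 : ℕ) + 1), Real.log x * x ^ (-s))
      (1 / (s - 1) ^ 2) := by
  rw [hasSum_iff_tendsto_nat_of_nonneg]
  · have hsum : ∀ N : ℕ, ∑ m ∈ range N,
        ∫ x in ((m : ℝ) + 1)..((m + 1 : ℕ) + 1), Real.log x * x ^ (-s) =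
        1 / (s - 1) ^ 2 - (Real.log ((N : ℝ) + 1) * ((N : ℝ) + 1) ^ (-(s - 1)) / (s - 1) +
          ((N : ℝ) + 1) ^ (-(s - 1)) / (s - 1) ^ 2) := by
      intro N
      rw [sum_congr rfl fun m _ => integral_log_mul_rpow_neg (by positivity) (by positivity) hs.ne',
        sum_range_sub (fun m : ℕ => -(((m : ℝ) + 1) ^ (1 - s) *
          (Real.log ((m : ℝ) + 1) / (s - 1) + 1 / (s - 1) ^ 2)))]
      simp
      ring_nf
    simp_rw [hsum]
    have hN : Tendsto (fun N : ℕ => (N : ℝ) + 1) atTop atTop :=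
      tendsto_atTop_add_const_right _ _ tendsto_natCast_atTop_atTop
    have t1 : Tendsto (fun x : ℝ => x ^ (-(s - 1))) atTop (𝓝 0) :=
      tendsto_rpow_neg_atTop (by linarith)
    have t2 : Tendsto (fun x : ℝ => Real.log x * x ^ (-(s - 1))) atTop (𝓝 0) := by
      refine ((isLittleO_log_rpow_atTop (sub_pos.2 hs)).tendsto_div_nhds_zero).congr' ?_
      filter_upwards [eventually_gt_atTop 0] with x hx
      rw [Real.rpow_neg hx.le, div_eq_mul_inv]
    simpa using tendsto_const_nhds.sub (((t2.div_const (s - 1)).add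
      (t1.div_const ((s - 1) ^ 2))).comp hN)
  · intro m
    refine intervalIntegral.integral_nonneg (by push_cast; linarith) fun x hx => ?_
    have hm : (0 : ℝ) ≤ m := by positivity
    have hx1 : 1 ≤ x := by linarith [hx.1]
    have := Real.log_nonneg hx1
    positivity

/-- The integrals add up to `1 / (s - 1)^2`, which cancels the double pole of `-ζ'` and leaves the
derivative of the entire part. -/
lemma hasSum_logRpowGap {s : ℝ} (hs : 1 < s) :
    HasSum (fun m => (logRpowGap s m : ℂ)) (-deriv riemannZeta₀ s) := by
  have h := (hasSum_deriv_riemannZeta hs).sub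
    (Complex.hasSum_ofReal.2 (hasSum_integral_log_mul_rpow_neg hs))
  have hs1 : (s : ℂ) ≠ 1 := by exact_mod_cast hs.ne'
  have hd : HasDerivAt riemannZeta (-1 / ((s : ℂ) - 1) ^ 2 + deriv riemannZeta₀ s) s := by
    have h1 : HasDerivAt (fun z : ℂ => (z - 1)⁻¹ + riemannZeta₀ z)
        (-1 / ((s : ℂ) - 1) ^ 2 + deriv riemannZeta₀ s) s :=
      (((hasDerivAt_id (s : ℂ)).sub_const 1).inv (sub_ne_zero.2 hs1)).add
        (differentiable_riemannZeta₀ s).hasDerivAt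
    refine h1.congr_of_eventuallyEq ?_
    filter_upwards [isOpen_ne.mem_nhds hs1] with z hz
    exact riemannZeta_eq_inv_sub_add hz
  rw [hd.deriv] at h
  have e : -(-1 / ((s : ℂ) - 1) ^ 2 + deriv riemannZeta₀ s) - ((1 / (s - 1) ^ 2 : ℝ) : ℂ) =
      -deriv riemannZeta₀ s := by
    push_cast
    ring
  rw [e] at h
  exact h.congr_fun fun m => by rw [logRpowGap, Complex.ofReal_sub]

/-- Both sides of `hasSum_logRpowGap` pass to the limit `s → 1⁺`: the series by dominated
convergence, the other side by continuity. -/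
lemma tsum_logRpowGap_one : ((∑' m, logRpowGap 1 m : ℝ) : ℂ) = stieltjesConstant 1 := by
  have h1 : Tendsto (fun s : ℝ => ∑' m, logRpowGap s m) (𝓝[>] 1) (𝓝 (∑' m, logRpowGap 1 m)) := by
    refine tendsto_tsum_of_dominated_convergence
      ((summable_nat_add_one_rpow_neg (p := 3 / 2) (by norm_num)).mul_left 5)
      tendsto_logRpowGap ?_
    filter_upwards [Ioc_mem_nhdsGT (show (1 : ℝ) < 2 by norm_num)] with s hs m
    exact abs_logRpowGap_le hs.1.le hs.2 m
  have h2 : Tendsto (fun s : ℝ => -deriv riemannZeta₀ s) (𝓝[>] 1) (𝓝 (-deriv riemannZeta₀ 1)) := by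
    have hc : Continuous fun s : ℝ => -deriv riemannZeta₀ s :=
      (differentiable_riemannZeta₀.deriv.continuous.comp Complex.continuous_ofReal).neg
    simpa using hc.continuousAt.tendsto.mono_left (nhdsWithin_le_nhds (a := (1 : ℝ)))
  have h3 : stieltjesConstant 1 = -deriv riemannZeta₀ 1 := by
    simp [stieltjesConstant, iteratedDeriv_one]
  rw [h3]
  refine tendsto_nhds_unique (((Complex.continuous_ofReal.tendsto _).comp h1).congr' ?_) h2
  filter_upwards [self_mem_nhdsWithin] with s hs
  rw [Function.comp_apply, Complex.ofReal_tsum]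
  exact (hasSum_logRpowGap hs).tsum_eq

/-- The classical limit formula for the first Stieltjes constant. -/
theorem exists_stieltjesConstant_one_eq_limit : ∃ g : ℝ, (g : ℂ) = stieltjesConstant 1 ∧
    Tendsto (fun N : ℕ => ∑ m ∈ range N, Real.log (m + 1) / ((m : ℝ) + 1) -
      Real.log (N + 1) ^ 2 / 2) atTop (𝓝 g) := by
  refine ⟨_, tsum_logRpowGap_one, ?_⟩
  have hs : Summable (logRpowGap 1) :=
    .of_norm_bounded ((summable_nat_add_one_rpow_neg (p := 3 / 2) (by norm_num)).mul_left 5)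
      fun m => abs_logRpowGap_le le_rfl (by norm_num) m
  refine hs.hasSum.tendsto_sum_nat.congr fun N => ?_
  have : ∀ m : ℕ, logRpowGap 1 m = Real.log (m + 1) / ((m : ℝ) + 1) -
      (Real.log ((m + 1 : ℕ) + 1) ^ 2 / 2 - Real.log ((m : ℝ) + 1) ^ 2 / 2) := fun m => by
    rw [logRpowGap, integral_log_mul_rpow_neg_one (by positivity) (by positivity),
      Real.rpow_neg_one, ← div_eq_mul_inv]
  simp_rw [this]
  rw [sum_sub_distrib, sum_range_sub (fun m : ℕ => Real.log ((m : ℝ) + 1) ^ 2 / 2)]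
  simp

/-! ### The telescoping artanh sum -/

/-- The sum over `j` of `log n / ((2 j + 3) n ^ (2 j + 3))`, at `n = m + 1`. -/
noncomputable def logArtanhTerm (m : ℕ) : ℝ :=
  Real.log (m + 1) * ((Real.log (m + 2) - Real.log m) / 2 - 1 / (m + 1))

lemma hasSum_logArtanhTerm (m : ℕ) :
    HasSum (fun j : ℕ => Real.log (m + 1) * ((m : ℝ) + 1) ^ (-(2 * ((j : ℝ) + 1) + 1)) /
      (2 * ((j : ℝ) + 1) + 1)) (logArtanhTerm m) := by
  rcases Nat.eq_zero_or_pos m with rfl | hm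
  -- For `n = 1` the artanh series diverges, but the factor `log 1 = 0` kills every term.
  · simp [logArtanhTerm, hasSum_zero]
  have hm0 : (0 : ℝ) < m := by exact_mod_cast hm
  have hx : |1 / ((m : ℝ) + 1)| < 1 := by
    rw [abs_of_pos (by positivity), div_lt_one (by positivity)]
    linarith
  -- Removing the linear term leaves the odd powers from the third on.
  have h := (hasSum_nat_add_iff' 1).2 (Real.hasSum_log_sub_log_of_abs_lt_one hx)
  have e : Real.log (1 + 1 / ((m : ℝ) + 1)) - Real.log (1 - 1 / ((m : ℝ) + 1)) =
      Real.log (m + 2) - Real.log m := by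
    rw [show 1 + 1 / ((m : ℝ) + 1) = (m + 2) / (m + 1) by field_simp; ring,
      show 1 - 1 / ((m : ℝ) + 1) = m / (m + 1) by field_simp; ring,
      Real.log_div (by positivity) (by positivity), Real.log_div (by positivity) (by positivity)]
    ring
  rw [e] at h
  have h' := h.mul_left (Real.log (m + 1) / 2)
  have e' : Real.log (m + 1) / 2 * (Real.log (m + 2) - Real.log m -
      ∑ i ∈ range 1, 2 * (1 / (2 * (i : ℝ) + 1)) * (1 / ((m : ℝ) + 1)) ^ (2 * i + 1)) =
      logArtanhTerm m := by
    simp [logArtanhTerm]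
    ring
  rw [e'] at h'
  refine h'.congr_fun fun j => ?_
  have hp : ((m : ℝ) + 1) ^ (-(2 * ((j : ℝ) + 1) + 1)) =
      (1 / ((m : ℝ) + 1)) ^ (2 * (j + 1) + 1) := by
    rw [one_div, inv_pow, Real.rpow_neg (by positivity), ← Real.rpow_natCast]
    push_cast
    rfl
  rw [hp]
  push_cast
  field_simp

lemma logArtanhTerm_nonneg (m : ℕ) : 0 ≤ logArtanhTerm m := by
  refine (hasSum_logArtanhTerm m).nonneg fun j => ?_
  have := Real.log_nonneg (show (1 : ℝ) ≤ m + 1 by simp)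
  positivity

lemma sum_range_logArtanhTerm (N : ℕ) : ∑ m ∈ range N, logArtanhTerm m =
    Real.log N * Real.log (N + 1) / 2 - ∑ m ∈ range N, Real.log (m + 1) / ((m : ℝ) + 1) := by
  induction N with
  | zero => simp
  | succ N ih =>
    rw [sum_range_succ, sum_range_succ, ih, logArtanhTerm]
    push_cast
    rw [show (N : ℝ) + 1 + 1 = N + 2 by ring]
    ring

/-- Reconciles the telescoped `log N · log (N+1) / 2` with the `log (N+1)^2 / 2` of the limit
formula. -/
lemma tendsto_log_add_one_mul_log_sub :
    Tendsto (fun N : ℕ => Real.log (N + 1) * (Real.log (N + 1) - Real.log N) / 2) atTop (𝓝 0) := by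
  have h : Tendsto (fun x : ℝ => Real.log (x + 1) / x) atTop (𝓝 0) := by
    have h1 := ((Real.isLittleO_log_id_atTop.tendsto_div_nhds_zero).comp
      (tendsto_atTop_add_const_right atTop (1 : ℝ) tendsto_id)).mul
      ((tendsto_const_nhds (x := (1 : ℝ))).add tendsto_inv_atTop_zero)
    rw [zero_mul] at h1
    refine h1.congr' ?_
    filter_upwards [eventually_gt_atTop 0] with x hx
    simp only [Function.comp_apply, id]
    field_simp
  refine squeeze_zero' ?_ ?_ (h.comp tendsto_natCast_atTop_atTop)
  all_goals
    filter_upwards [eventually_gt_atTop 0] with N hN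
    have hN0 : (0 : ℝ) < N := by exact_mod_cast hN
    have h0 := Real.log_nonneg (show (1 : ℝ) ≤ N + 1 by simp)
    have h1 : 0 ≤ Real.log (N + 1) - Real.log N :=
      sub_nonneg.2 (Real.log_le_log hN0 (by linarith))
  · positivity
  · have h2 : Real.log (N + 1) - Real.log N ≤ 1 / N := by
      rw [← Real.log_div (by positivity) hN0.ne']
      refine (Real.log_le_sub_one_of_pos (by positivity)).trans_eq ?_
      field_simp
      ring
    simp only [Function.comp_apply]
    calc Real.log (N + 1) * (Real.log (N + 1) - Real.log N) / 2
        ≤ Real.log (N + 1) * (Real.log (N + 1) - Real.log N) := half_le_self (mul_nonneg h0 h1)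
      _ ≤ Real.log (N + 1) * (1 / N) := mul_le_mul_of_nonneg_left h2 h0
      _ = Real.log (N + 1) / N := by ring

lemma hasSum_logArtanhTerm_stieltjesConstant :
    ∃ g : ℝ, (g : ℂ) = stieltjesConstant 1 ∧ HasSum logArtanhTerm (-g) := by
  obtain ⟨g, hg, hlim⟩ := exists_stieltjesConstant_one_eq_limit
  refine ⟨g, hg, ?_⟩
  rw [hasSum_iff_tendsto_nat_of_nonneg logArtanhTerm_nonneg]
  have h := (hlim.add tendsto_log_add_one_mul_log_sub).neg
  rw [add_zero] at h
  refine h.congr fun N => ?_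
  rw [sum_range_logArtanhTerm]
  ring

theorem mainTheorem5 :
    HasSum (fun j : ℕ => deriv riemannZeta (2 * ((j : ℂ) + 1) + 1) / (2 * ((j : ℂ) + 1) + 1))
      (stieltjesConstant 1) := by
  obtain ⟨g, hg, hsum⟩ := hasSum_logArtanhTerm_stieltjesConstant
  let F : ℕ × ℕ → ℝ := fun p =>
    Real.log (p.1 + 1) * ((p.1 : ℝ) + 1) ^ (-(2 * ((p.2 : ℝ) + 1) + 1)) / (2 * ((p.2 : ℝ) + 1) + 1)
  have hF0 : 0 ≤ F := fun p => by
    have := Real.log_nonneg (show (1 : ℝ) ≤ p.1 + 1 by simp)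
    simp only [F, Pi.zero_apply]
    positivity
  -- Tonelli: for nonnegative terms, summability of the iterated sum suffices.
  have hFs : Summable F := (summable_prod_of_nonneg hF0).2
    ⟨fun m => (hasSum_logArtanhTerm m).summable,
      hsum.summable.congr fun m => (hasSum_logArtanhTerm m).tsum_eq.symm⟩
  have hF : HasSum F (-g) := by
    rw [← (hFs.hasSum.prod_fiberwise hasSum_logArtanhTerm).unique hsum]
    exact hFs.hasSum
  have hswap : HasSum (fun p : ℕ × ℕ => ((F p.swap : ℝ) : ℂ)) ((-g : ℝ) : ℂ) :=
    Complex.hasSum_ofReal.2 ((Equiv.prodComm ℕ ℕ).hasSum_iff.2 hF)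
  have hj : ∀ j : ℕ, HasSum (fun m : ℕ => ((F (m, j) : ℝ) : ℂ))
      (-deriv riemannZeta (2 * ((j : ℂ) + 1) + 1) / (2 * ((j : ℂ) + 1) + 1)) := fun j => by
    have h := (hasSum_deriv_riemannZeta (s := 2 * ((j : ℝ) + 1) + 1)
      (by have : (0 : ℝ) ≤ j := by positivity
          linarith)).div_const ((2 * ((j : ℝ) + 1) + 1 : ℝ) : ℂ)
    have hc : ((2 * ((j : ℝ) + 1) + 1 : ℝ) : ℂ) = 2 * ((j : ℂ) + 1) + 1 := by push_cast; rfl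
    rw [hc] at h
    exact h.congr_fun fun m => by simp only [F]; rw [Complex.ofReal_div, hc]
  have h := (hswap.prod_fiberwise hj).neg
  rw [Complex.ofReal_neg, neg_neg, hg] at h
  refine h.congr_fun fun j => ?_
  ring
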